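/- All logarithms are to base $2$, and $\{0,1\}^n$ is identified with $\mathbb F_2^n$. Let $U_m$ denote the uniform distribution on $\{0,1\}^m$. A distribution $X$ on $\{0,1\}^n$ is an *$\ell$-local source* if $X=f(U_m)$ for some $m\in\mathbb N$ and some $f:\{0,1\}^m\to\{0,1\}^n$ each of whose output bits depends on at most $\ell$ input bits; it is a *depth-$\ell$ decision forest source* if $X=f(U_m)$ for some $m\in\mathbb N$ and some $f:\{0,1\}^m\to\{0,1\}^n$ each of whose output bits is computed by a decision tree of depth at most $\ell$ querying the input bits. The min-entropy of $X$ is $\mathrm H_\infty(X)=\min_{x\in\mathrm{support}(X)}-\log\Pr[X=x]$. A function $D:\{0,1\}^n\to\{0,1\}$ is a *disperser* for a family $\mathcal X$ of distributions on $\{0,1\}^n$ with min-entropy $k$ if for every $X\in\mathcal X$ with $\mathrm H_\infty(X)\ge k$ the support of $D(X)$ is $\{0,1\}$. Let $1\le \ell\le d\le n$ be integers. There exists a polynomial $p\in\mathbb F_2[X_1,\dots,X_n]$ of total degree at most $d$ and of degree at most $1$ in each variable such that the function $x\mapsto p(x)$ on $\mathbb F_2^n$ is a disperser 1. for the family of $\ell$-local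 sources on $\{0,1\}^n$ with min-entropy $k$, for every integer $k> d\,(2^\ell n+2\ell n\log n)^{1/d}$; and 2. for the family of depth-$\ell$ decision forest sources on $\{0,1\}^n$ with min-entropy $k$, for every integer $k> d\,((\ell+\log n)2^{\ell+1}n)^{1/d}$. -/

import Mathlib

noncomputable section

/-- The Boolean cube `{0,1}ⁿ`, identified with `𝔽₂ⁿ`. -/
abbrev Cube (n : ℕ) : Type := Fin n → ZMod 2

/-- Polynomials over `𝔽₂` in `n` variables of total degree at most `d` and individual degrees at
most `1`. -/
def Poly₂ (n d : ℕ) : Set (MvPolynomial (Fin n) (ZMod 2)) :=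
  {p | p.totalDegree ≤ d ∧ ∀ i, p.degreeOf i ≤ 1}

/-- The distribution `f(U_m)`, where `U_m` is uniform on `{0,1}^m`. -/
def sourceOf {m n : ℕ} (f : Cube m → Cube n) : PMF (Cube n) :=
  (PMF.uniformOfFintype (Cube m)).map f

/-- The min-entropy `min_{x ∈ support X} -log₂ Pr[X = x]`. -/
def minEntropy {n : ℕ} (X : PMF (Cube n)) : ℝ :=
  ⨅ x : X.support, -Real.logb 2 (X x).toReal

/-- Every output bit of `f` depends on at most `ℓ` of its input bits. -/
def IsLocalMap {m n : ℕ} (ℓ : ℕ) (f : Cube m → Cube n) : Prop :=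
  ∀ j : Fin n, ∃ S : Finset (Fin m), S.card ≤ ℓ ∧ DependsOn (fun x => f x j) (S : Set (Fin m))

/-- Decision trees querying the bits of an input from `{0,1}^m`, with leaves labelled by bits. -/
inductive DecisionTree (m : ℕ) : Type
  | leaf (b : ZMod 2) : DecisionTree m
  | query (i : Fin m) (t₀ t₁ : DecisionTree m) : DecisionTree m

namespace DecisionTree

/-- The largest number of queries on a path from the root to a leaf. -/
def depth {m : ℕ} : DecisionTree m → ℕ
  | leaf _ => 0
  | query _ t₀ t₁ => max t₀.depth t₁.depth + 1

/-- The output on `x`: at a node querying `i`, continue in `t₀` if `x i = 0` and in `t₁` if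
`x i = 1`. -/
def eval {m : ℕ} : DecisionTree m → Cube m → ZMod 2
  | leaf b, _ => b
  | query i t₀ t₁, x => if x i = 0 then t₀.eval x else t₁.eval x

end DecisionTree

/-- Every output bit of `f` is computed by a decision tree of depth at most `ℓ`. -/
def IsDecisionForest {m n : ℕ} (ℓ : ℕ) (f : Cube m → Cube n) : Prop :=
  ∀ j : Fin n, ∃ t : DecisionTree m, t.depth ≤ ℓ ∧ ∀ x, f x j = t.eval x

/-- The `ℓ`-local sources on `{0,1}ⁿ` (with any number `m` of input bits). -/
def localSources (ℓ n : ℕ) : Set (PMF (Cube n)) :=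
  {X | ∃ (m : ℕ) (f : Cube m → Cube n), IsLocalMap ℓ f ∧ X = sourceOf f}

/-- The depth-`ℓ` decision forest sources on `{0,1}ⁿ` (with any number `m` of input bits). -/
def decisionForestSources (ℓ n : ℕ) : Set (PMF (Cube n)) :=
  {X | ∃ (m : ℕ) (f : Cube m → Cube n), IsDecisionForest ℓ f ∧ X = sourceOf f}

/-- `D` is a disperser for the family `𝒳` with min-entropy `k`: for every `X ∈ 𝒳` of min-entropy at
least `k`, the support of `D(X)` is all of `{0,1}`. -/
def IsDisperser {n : ℕ} (D : Cube n → ZMod 2) (𝒳 : Set (PMF (Cube n))) (k : ℕ) : Prop :=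
  ∀ X ∈ 𝒳, (k : ℝ) ≤ minEntropy X → (X.map D).support = Set.univ

end

/-! The proof is a probabilistic argument by counting. Whether `p` disperses a source depends only
on the source's support, the range of `f`, and min-entropy at least `k` forces at least `2 ^ k`
points there.

The functions of degree at most `d`, restricted to a set `S` of at least `2 ^ k` points, span a
space of dimension at least the number of `i < S.card` of binary weight at most `d`
(`exists_independentOn`), hence at least `∑ i ≤ d, k.choose i`. A uniformly random such function is
therefore constant on `S` with probability at most two to the power one minus that sum
(`card_constantOn_mul_le`).

Each output bit reads few inputs, so `m` can be replaced by a bound in `n` and `ℓ`, and there are at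
most `2 ^ A` possible ranges, `A` being the quantity under the `d`-th root. As `k.choose d ≥ (k / d)
^ d > A`, a union bound over both families leaves a good polynomial. -/

open MvPolynomial

/-! ### Counting integers of small binary weight -/

/-- The number of ones in the binary expansion of a natural number. -/
def binaryWeight (i : ℕ) : ℕ := (Nat.digits 2 i).sum

/-- The number of `i < s` of binary weight less than `d`. -/
def lowWeightCount (d s : ℕ) : ℕ := ∑ i ∈ Finset.range s, if binaryWeight i < d then 1 else 0

lemma binaryWeight_two_mul (i : ℕ) : binaryWeight (2 * i) = binaryWeight i := by
  rcases Nat.eq_zero_or_pos i with rfl | hi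
  · simp
  · unfold binaryWeight
    rw [Nat.digits_def' (by norm_num) (by omega)]
    simp

lemma binaryWeight_two_mul_add_one (i : ℕ) : binaryWeight (2 * i + 1) = binaryWeight i + 1 := by
  unfold binaryWeight
  rw [Nat.digits_def' (by norm_num) (by omega)]
  rw [show (2 * i + 1) / 2 = i by omega]
  simp [Nat.add_mod, add_comm]

@[simp] lemma lowWeightCount_weight_zero (s : ℕ) : lowWeightCount 0 s = 0 := by
  simp [lowWeightCount]

@[simp] lemma lowWeightCount_zero (d : ℕ) : lowWeightCount d 0 = 0 := by
  simp [lowWeightCount]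

@[simp] lemma lowWeightCount_succ_one (d : ℕ) : lowWeightCount (d + 1) 1 = 1 := by
  rw [lowWeightCount, Finset.sum_range_one]
  simp [binaryWeight]

lemma lowWeightCount_succ (d s : ℕ) :
    lowWeightCount d (s + 1) = lowWeightCount d s + if binaryWeight s < d then 1 else 0 := by
  rw [lowWeightCount, Finset.sum_range_succ, lowWeightCount]

/-- Split by the last binary digit: removing it keeps the weight of even numbers and lowers that of
odd ones by one. -/
lemma lowWeightCount_two_mul (d s : ℕ) :
    lowWeightCount (d + 1) (2 * s) = lowWeightCount (d + 1) s + lowWeightCount d s := by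
  induction s with
  | zero => simp
  | succ s ih =>
    rw [show 2 * (s + 1) = 2 * s + 1 + 1 by ring, lowWeightCount_succ, lowWeightCount_succ, ih,
      lowWeightCount_succ, lowWeightCount_succ, binaryWeight_two_mul_add_one,
      binaryWeight_two_mul]
    simp only [Nat.add_lt_add_iff_right]
    ring

lemma lowWeightCount_two_mul_add_one (d s : ℕ) :
    lowWeightCount (d + 1) (2 * s + 1) = lowWeightCount (d + 1) (s + 1) + lowWeightCount d s := by
  rw [lowWeightCount_succ, lowWeightCount_two_mul, lowWeightCount_succ, binaryWeight_two_mul]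
  ring

lemma lowWeightCount_mono (d : ℕ) {s t : ℕ} (h : s ≤ t) :
    lowWeightCount d s ≤ lowWeightCount d t :=
  Finset.sum_le_sum_of_subset (Finset.range_subset_range.2 h)

/-- This is the inequality needed to glue two slices of sizes `a` and `b` in the Hilbert function
bound. Halving `a` and `b` reduces it to smaller instances at two consecutive weights. -/
lemma lowWeightCount_add_le (a b d : ℕ) (hba : b ≤ a) :
    lowWeightCount (d + 1) (a + b) ≤ lowWeightCount (d + 1) a + lowWeightCount d b := by
  induction hs : a + b using Nat.strong_induction_on generalizing a b d with
  | _ s ih =>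
    subst hs
    rcases Nat.eq_zero_or_pos b with rfl | hb
    · simp
    by_cases h11 : a = 1
    · obtain rfl : b = 1 := by omega
      subst h11
      have h2 := lowWeightCount_two_mul d 1
      norm_num at h2 ⊢
      omega
    -- At `d = 0` the weight-`d` counts vanish, so the truncated `d - 1` is harmless.
    have key : ∀ a' b' : ℕ, b' ≤ a' → a' + b' < a + b →
        lowWeightCount (d + 1) (a' + b') ≤ lowWeightCount (d + 1) a' + lowWeightCount d b' ∧
        lowWeightCount d (a' + b') ≤ lowWeightCount d a' + lowWeightCount (d - 1) b' := by
      intro a' b' h1 h2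
      refine ⟨ih _ h2 _ _ _ h1 rfl, ?_⟩
      rcases d with _ | d
      · simp
      · exact ih _ h2 _ _ _ h1 rfl
    have even (s : ℕ) : lowWeightCount d (2 * s) = lowWeightCount d s + lowWeightCount (d - 1) s := by
      rcases d with _ | d
      · simp
      · exact lowWeightCount_two_mul d s
    have odd (s : ℕ) :
        lowWeightCount d (2 * s + 1) = lowWeightCount d (s + 1) + lowWeightCount (d - 1) s := by
      rcases d with _ | d
      · simp
      · exact lowWeightCount_two_mul_add_one d s
    rcases Nat.even_or_odd' a with ⟨α, rfl | rfl⟩ <;> rcases Nat.even_or_odd' b with ⟨β, rfl | rfl⟩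
    · rw [← mul_add, lowWeightCount_two_mul, lowWeightCount_two_mul, even]
      have := key α β (by omega) (by omega)
      omega
    · rw [show 2 * α + (2 * β + 1) = 2 * (α + β) + 1 by ring, lowWeightCount_two_mul_add_one,
        lowWeightCount_two_mul, odd]
      have h1 := (key α (β + 1) (by omega) (by omega)).1
      have h2 := (key α β (by omega) (by omega)).2
      rw [← add_assoc] at h1
      omega
    · rw [show 2 * α + 1 + 2 * β = 2 * (α + β) + 1 by ring, lowWeightCount_two_mul_add_one,
        lowWeightCount_two_mul_add_one, even]
      have h1 := (key (α + 1) β (by omega) (by omega)).1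
      have h2 := (key α β (by omega) (by omega)).2
      rw [add_right_comm] at h1
      omega
    · rw [show 2 * α + 1 + (2 * β + 1) = 2 * (α + β + 1) by ring, lowWeightCount_two_mul,
        lowWeightCount_two_mul_add_one, odd]
      have h1 := (key (α + 1) β (by omega) (by omega)).1
      rw [add_right_comm] at h1
      -- The pair `(α, β + 1)` is admissible only if `β < α`; the surplus is then absorbed because
      -- an increment at weight `d - 1` is at most the one at `d`. If `α = β`, the pair is swapped.
      rcases Nat.lt_or_ge β α with h | h
      · have h2 := (key α (β + 1) (by omega) (by omega)).2
        rw [← add_assoc] at h2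
        have h3 := lowWeightCount_succ d β
        have h4 := lowWeightCount_succ (d - 1) β
        have h5 : (if binaryWeight β < d - 1 then 1 else 0) ≤ if binaryWeight β < d then 1 else 0 := by
          split_ifs <;> omega
        omega
      · obtain rfl : β = α := by omega
        have h2 := (key (β + 1) β (by omega) (by omega)).2
        rw [add_right_comm] at h2
        omega

/-- At powers of two the doubling recursion is Pascal's rule. -/
lemma sum_choose_le_lowWeightCount (d k : ℕ) :
    ∑ i ∈ Finset.range d, k.choose i ≤ lowWeightCount d (2 ^ k) := by
  induction k generalizing d with
  | zero =>
    rcases d with _ | d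
    · simp
    · rw [Finset.sum_range_succ']
      simp
  | succ k ih =>
    rcases d with _ | d
    · simp
    · rw [pow_succ', lowWeightCount_two_mul]
      refine le_trans (le_of_eq ?_) (add_le_add (ih (d + 1)) (ih d))
      rw [Finset.sum_range_succ', Finset.sum_range_succ' (fun i => k.choose i)]
      simp only [Nat.choose_succ_succ, Finset.sum_add_distrib, Nat.choose_zero_right]
      ring

/-! ### The Hilbert function of a subset of the cube -/

/-- A family of multilinear polynomials of total degree less than `d` that is linearly
independent as a family of functions on `S`. -/
structure IndependentOn {n : ℕ} {ι : Type} [Fintype ι] (S : Finset (Cube n)) (d : ℕ)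
    (g : ι → MvPolynomial (Fin n) (ZMod 2)) : Prop where
  totalDegree_lt : ∀ t, (g t).totalDegree < d
  degreeOf_le : ∀ t i, (g t).degreeOf i ≤ 1
  eq_zero : ∀ c : ι → ZMod 2, (∀ x ∈ S, ∑ t, c t * eval x (g t) = 0) → c = 0

lemma IndependentOn.of_isEmpty {n d : ℕ} {ι : Type} [Fintype ι] [IsEmpty ι] (S : Finset (Cube n))
    (g : ι → MvPolynomial (Fin n) (ZMod 2)) : IndependentOn S d g :=
  ⟨fun t => isEmptyElim t, fun t => isEmptyElim t, fun _ _ => Subsingleton.elim _ _⟩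

/-- The slice of `S` on which the first coordinate is `a`. -/
def slice {n : ℕ} (S : Finset (Cube (n + 1))) (a : ZMod 2) : Finset (Cube n) :=
  Finset.univ.filter fun y => (Fin.cons a y : Cube (n + 1)) ∈ S

lemma card_slice_add_card_slice {n : ℕ} (S : Finset (Cube (n + 1))) (a : ZMod 2) :
    (slice S a).card + (slice S (a + 1)).card = S.card := by
  classical
  have h (b : ZMod 2) : (slice S b).card = (S.filter fun x => x 0 = b).card := by
    refine Finset.card_bij (fun y _ => (Fin.cons b y : Cube (n + 1))) ?_ ?_ ?_
    · intro y hy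
      simpa [slice] using hy
    · intro y _ z _ hyz
      exact (Fin.cons_injective2 hyz).2
    · intro x hx
      rw [Finset.mem_filter] at hx
      obtain ⟨hx, rfl⟩ := hx
      exact ⟨Fin.tail x, by simpa [slice] using hx, by simp⟩
  rw [h, h, ← Finset.card_filter_add_card_filter_not (s := S) (fun x => x 0 = a)]
  congr 2
  refine Finset.filter_congr fun x _ => ?_
  generalize x 0 = b
  revert a b
  decide

/-- The factor `X 0 + C a` vanishes on the slice `a` and equals `1` on the other. A relation
restricted to slice `a` kills the coefficients of `g`, and then the other slice kills those of `h`.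
-/
lemma IndependentOn.sumElim {n d : ℕ} {ι κ : Type} [Fintype ι] [Fintype κ]
    {S : Finset (Cube (n + 1))} {a : ZMod 2} {g : ι → MvPolynomial (Fin n) (ZMod 2)}
    {h : κ → MvPolynomial (Fin n) (ZMod 2)} (hg : IndependentOn (slice S a) (d + 1) g)
    (hh : IndependentOn (slice S (a + 1)) d h) :
    IndependentOn S (d + 1) (Sum.elim (fun t => rename Fin.succ (g t))
      fun t => (X 0 + C a) * rename Fin.succ (h t)) := by
  have hX : (X 0 + C a : MvPolynomial (Fin (n + 1)) (ZMod 2)).totalDegree ≤ 1 :=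
    (totalDegree_add _ _).trans (by simp)
  have hdeg (p : MvPolynomial (Fin n) (ZMod 2)) (hp : ∀ i, p.degreeOf i ≤ 1) (i : Fin (n + 1)) :
      (rename Fin.succ p).degreeOf i ≤ if i = 0 then 0 else 1 := by
    refine Fin.cases ?_ (fun i => ?_) i
    · rw [if_pos rfl, degreeOf_le_iff]
      intro m hm
      rw [Nat.le_zero]
      by_contra h0
      obtain ⟨u, rfl, -⟩ := coeff_rename_ne_zero _ _ _ (mem_support_iff.1 hm)
      refine h0 (Finsupp.mapDomain_of_notMem_range _ _ ?_)
      rintro ⟨j, hj⟩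
      exact Fin.succ_ne_zero j hj
    · rw [degreeOf_rename_of_injective (Fin.succ_injective n)]
      simpa using hp i
  constructor
  · rintro (t | t)
    · exact (totalDegree_rename_le _ _).trans_lt (hg.totalDegree_lt t)
    · have h1 := totalDegree_mul (X 0 + C a) (rename Fin.succ (h t))
      have h2 := (totalDegree_rename_le Fin.succ (h t)).trans_lt (hh.totalDegree_lt t)
      simp only [Sum.elim_inr]
      omega
  · rintro (t | t) i
    · exact (hdeg _ (hg.degreeOf_le t) i).trans (by split_ifs <;> simp)
    · refine (degreeOf_mul_le _ _ _).trans ?_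
      have h1 := hdeg _ (hh.degreeOf_le t) i
      have h2 : (X 0 + C a : MvPolynomial (Fin (n + 1)) (ZMod 2)).degreeOf i
          ≤ if i = 0 then 1 else 0 := by
        refine (degreeOf_add_le _ _ _).trans ?_
        rw [degreeOf_C, degreeOf_X]
        simp
      split_ifs at h1 h2 <;> omega
  · intro c hc
    have haa : a + a = 0 := CharTwo.add_self_eq_zero a
    have heval (b : ZMod 2) (y : Cube n) (p : MvPolynomial (Fin n) (ZMod 2)) :
        eval (Fin.cons b y : Cube (n + 1)) (rename Fin.succ p) = eval y p := by
      rw [eval_rename]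
      congr 1
    have hcg : (fun t => c (Sum.inl t)) = 0 := hg.eq_zero _ fun y hy => by
      have := hc (Fin.cons a y) (by simpa [slice] using hy)
      simpa [Fintype.sum_sum_type, heval, haa] using this
    have hcg' (t : ι) : c (Sum.inl t) = 0 := congrFun hcg t
    have hch : (fun t => c (Sum.inr t)) = 0 := hh.eq_zero _ fun y hy => by
      have := hc (Fin.cons (a + 1) y) (by simpa [slice] using hy)
      simpa [Fintype.sum_sum_type, heval, hcg', add_right_comm a 1 a, haa] using this
    funext t
    rcases t with t | t
    · exact hcg' t
    · exact congrFun hch t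

/-- The Hilbert function of a set of `s` points of the cube is at least that of the initial
segment of length `s`. -/
theorem exists_independentOn {n : ℕ} (S : Finset (Cube n)) (d : ℕ) :
    ∃ (ι : Type) (_ : Fintype ι) (g : ι → MvPolynomial (Fin n) (ZMod 2)),
      lowWeightCount d S.card ≤ Fintype.card ι ∧ IndependentOn S d g := by
  induction n generalizing d with
  | zero =>
    rcases d with _ | d
    · exact ⟨Empty, inferInstance, Empty.elim, by simp, .of_isEmpty _ _⟩
    rcases S.eq_empty_or_nonempty with rfl | ⟨x, hx⟩
    · exact ⟨Empty, inferInstance, Empty.elim, by simp, .of_isEmpty _ _⟩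
    · refine ⟨Unit, inferInstance, fun _ => 1, ?_, by simp, by simp, ?_⟩
      · have : S.card ≤ 1 := Finset.card_le_one_of_subsingleton S
        exact (lowWeightCount_mono _ this).trans (by simp)
      · intro c hc
        funext t
        simpa using hc x hx
  | succ n ih =>
    rcases d with _ | d
    · exact ⟨Empty, inferInstance, Empty.elim, by simp, .of_isEmpty _ _⟩
    -- The larger slice keeps the full degree, as `lowWeightCount_add_le` requires.
    obtain ⟨a, ha⟩ : ∃ a, (slice S (a + 1)).card ≤ (slice S a).card := by
      rcases le_total (slice S 1).card (slice S 0).card with h | h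
      · exact ⟨0, by simpa using h⟩
      · exact ⟨1, by simpa [show (1 : ZMod 2) + 1 = 0 from rfl] using h⟩
    obtain ⟨ι, _, g, hgc, hg⟩ := ih (slice S a) (d + 1)
    obtain ⟨κ, _, h, hhc, hh⟩ := ih (slice S (a + 1)) d
    refine ⟨ι ⊕ κ, inferInstance, _, ?_, hg.sumElim hh⟩
    rw [← card_slice_add_card_slice S a, Fintype.card_sum]
    exact (lowWeightCount_add_le _ _ _ ha).trans (add_le_add hgc hhc)

/-! ### Union bound over sets on which a polynomial is constant -/

/-- The functions on the cube given by polynomials in `Poly₂ n d`. -/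
noncomputable def polyFunctions (n d : ℕ) : Submodule (ZMod 2) (Cube n → ZMod 2) :=
  (restrictTotalDegree (Fin n) (ZMod 2) d ⊓ restrictDegree (Fin n) (ZMod 2) 1).map
    (LinearMap.pi fun x => (aeval x : MvPolynomial (Fin n) (ZMod 2) →ₐ[ZMod 2] ZMod 2).toLinearMap)

lemma mem_polyFunctions {n d : ℕ} {q : Cube n → ZMod 2} :
    q ∈ polyFunctions n d ↔ ∃ p ∈ Poly₂ n d, (fun x => eval x p) = q := by
  have h (p : MvPolynomial (Fin n) (ZMod 2)) : p ∈ Poly₂ n d ↔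
      p ∈ restrictTotalDegree (Fin n) (ZMod 2) d ⊓ restrictDegree (Fin n) (ZMod 2) 1 := by
    rw [Submodule.mem_inf, mem_restrictTotalDegree, mem_restrictDegree]
    refine and_congr Iff.rfl ?_
    simp only [degreeOf_le_iff]
    tauto
  simp only [polyFunctions, Submodule.mem_map, h]
  refine exists_congr fun p => and_congr Iff.rfl ?_
  simp [funext_iff, aeval_eq_eval]

open Classical in
/-- The functions in `polyFunctions n d` that are constantly `b` on `S`. -/
noncomputable def constantOn {n : ℕ} (d : ℕ) (S : Finset (Cube n)) (b : ZMod 2) : Finset (Cube n → ZMod 2) :=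
  Finset.univ.filter fun q => q ∈ polyFunctions n d ∧ ∀ x ∈ S, q x = b

/-- Adding combinations of an independent family to functions constant on `S` is injective: the
values on `S` determine the combination. -/
lemma card_constantOn_mul_le {n : ℕ} (d : ℕ) (S : Finset (Cube n)) (b : ZMod 2) :
    (constantOn d S b).card * 2 ^ lowWeightCount (d + 1) S.card ≤
      Nat.card (polyFunctions n d) := by
  classical
  obtain ⟨ι, _, g, hcard, hg⟩ := exists_independentOn S (d + 1)
  have hgmem (t : ι) : (fun x => eval x (g t)) ∈ polyFunctions n d :=
    mem_polyFunctions.2 ⟨g t, ⟨Nat.lt_succ_iff.1 (hg.totalDegree_lt t), hg.degreeOf_le t⟩, rfl⟩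
  let F : constantOn d S b × (ι → ZMod 2) → polyFunctions n d := fun a =>
    ⟨a.1.1 + ∑ t, a.2 t • fun x => eval x (g t),
      add_mem (Finset.mem_filter.1 a.1.2).2.1
        (sum_mem fun t _ => Submodule.smul_mem _ _ (hgmem t))⟩
  have hF : Function.Injective F := by
    rintro ⟨⟨q, hq⟩, c⟩ ⟨⟨q', hq'⟩, c'⟩ h
    have h' : q + ∑ t, c t • (fun x => eval x (g t)) =
        q' + ∑ t, c' t • fun x => eval x (g t) := congrArg Subtype.val h
    have hc : c = c' := sub_eq_zero.1 <| hg.eq_zero _ fun x hx => by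
      have := congrFun h' x
      have h1 := (Finset.mem_filter.1 hq).2.2 x hx
      have h2 := (Finset.mem_filter.1 hq').2.2 x hx
      simp only [Pi.add_apply, Finset.sum_apply, Pi.smul_apply, smul_eq_mul, h1, h2,
        add_right_inj] at this
      simp [sub_mul, Finset.sum_sub_distrib, this]
    subst hc
    simpa using h'
  calc _ ≤ (constantOn d S b).card * 2 ^ Fintype.card ι :=
        Nat.mul_le_mul_left _ (Nat.pow_le_pow_right (by norm_num) hcard)
    _ = Nat.card (constantOn d S b × (ι → ZMod 2)) := by simp
    _ ≤ _ := Nat.card_le_card_of_injective F hF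

/-- The `8` is `2 * 4`: two possible constants, and a bad fraction of at most a quarter, so that two
families can be treated at once. -/
lemma four_mul_card_biUnion_constantOn_le {n d r : ℕ} (F : Finset (Finset (Cube n)))
    (hr : ∀ S ∈ F, r ≤ lowWeightCount (d + 1) S.card) (hF : F.card * 8 ≤ 2 ^ r)
    [DecidableEq (Cube n → ZMod 2)] :
    4 * ((F ×ˢ Finset.univ).biUnion fun a : Finset (Cube n) × ZMod 2 => constantOn d a.1 a.2).card ≤
      Nat.card (polyFunctions n d) := by
  refine Nat.le_of_mul_le_mul_right ?_ (show 0 < 2 ^ r by positivity)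
  calc _ ≤ 4 * (∑ a ∈ F ×ˢ (Finset.univ : Finset (ZMod 2)), (constantOn d a.1 a.2).card) * 2 ^ r := by
        gcongr
        exact Finset.card_biUnion_le
    _ = 4 * ∑ a ∈ F ×ˢ (Finset.univ : Finset (ZMod 2)), (constantOn d a.1 a.2).card * 2 ^ r := by
        rw [mul_assoc, Finset.sum_mul]
    _ ≤ 4 * ∑ a ∈ F ×ˢ (Finset.univ : Finset (ZMod 2)), Nat.card (polyFunctions n d) := by
        gcongr with a ha
        refine le_trans ?_ (card_constantOn_mul_le d a.1 a.2)
        gcongr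
        · norm_num
        · exact hr _ (Finset.mem_product.1 ha).1
    _ = F.card * 8 * Nat.card (polyFunctions n d) := by
        simp [ZMod.card]
        ring
    _ ≤ _ := by
        rw [mul_comm]
        gcongr

/-- Some polynomial of degree at most `d` is nonconstant on all members of two small families of
large sets. -/
theorem exists_poly_forall_nonconstant {n d r₁ r₂ : ℕ} (F₁ F₂ : Finset (Finset (Cube n)))
    (hr₁ : ∀ S ∈ F₁, r₁ ≤ lowWeightCount (d + 1) S.card) (hF₁ : F₁.card * 8 ≤ 2 ^ r₁)
    (hr₂ : ∀ S ∈ F₂, r₂ ≤ lowWeightCount (d + 1) S.card) (hF₂ : F₂.card * 8 ≤ 2 ^ r₂) :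
    ∃ p ∈ Poly₂ n d, ∀ S, S ∈ F₁ ∨ S ∈ F₂ → ∀ b, ∃ x ∈ S, eval x p = b := by
  classical
  have h₁ := four_mul_card_biUnion_constantOn_le F₁ hr₁ hF₁
  have h₂ := four_mul_card_biUnion_constantOn_le F₂ hr₂ hF₂
  set B₁ := (F₁ ×ˢ Finset.univ).biUnion fun a : Finset (Cube n) × ZMod 2 => constantOn d a.1 a.2
    with hB₁
  set B₂ := (F₂ ×ˢ Finset.univ).biUnion fun a : Finset (Cube n) × ZMod 2 => constantOn d a.1 a.2
    with hB₂
  have hpos : 0 < Nat.card (polyFunctions n d) := Nat.card_pos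
  have hcard : Nat.card (polyFunctions n d) =
      (Finset.univ.filter fun q => q ∈ polyFunctions n d).card := by
    rw [Nat.card_eq_fintype_card]
    exact Fintype.card_subtype _
  obtain ⟨q, hq, hqB⟩ : ∃ q ∈ Finset.univ.filter (fun q => q ∈ polyFunctions n d),
      q ∉ B₁ ∪ B₂ := by
    refine Finset.exists_mem_notMem_of_card_lt_card ?_
    have := Finset.card_union_le B₁ B₂
    omega
  rw [Finset.mem_filter] at hq
  obtain ⟨p, hp, rfl⟩ := mem_polyFunctions.1 hq.2
  refine ⟨p, hp, fun S hS b => ?_⟩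
  by_contra! hne
  refine hqB (Finset.mem_union.2 ?_)
  have hconst : (fun x => eval x p) ∈ constantOn d S (b + 1) := by
    refine Finset.mem_filter.2 ⟨Finset.mem_univ _, hq.2, fun x hx => ?_⟩
    have h (b c : ZMod 2) : c ≠ b → c = b + 1 := by
      revert b c
      decide
    exact h b _ (hne x hx)
  refine hS.imp (fun h => ?_) fun h => ?_ <;>
  exact Finset.mem_biUnion.2 ⟨(S, b + 1), Finset.mem_product.2 ⟨h, Finset.mem_univ _⟩, hconst⟩

/-! ### Supports of sources and min-entropy -/

/-- The support of `f(U_m)`. -/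
def rangeFinset {m n : ℕ} (f : Cube m → Cube n) : Finset (Cube n) := Finset.univ.image f

@[simp] lemma mem_rangeFinset {m n : ℕ} {f : Cube m → Cube n} {y : Cube n} :
    y ∈ rangeFinset f ↔ ∃ x, f x = y := by
  simp [rangeFinset]

lemma mem_support_sourceOf {m n : ℕ} {f : Cube m → Cube n} {y : Cube n} :
    y ∈ (sourceOf f).support ↔ ∃ x, f x = y := by
  simp [sourceOf]

/-- Every point of the support has mass at most `2 ^ (-k)`, and the masses sum to `1`. -/
lemma two_pow_le_card_rangeFinset {m n k : ℕ} {f : Cube m → Cube n}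
    (h : (k : ℝ) ≤ minEntropy (sourceOf f)) : 2 ^ k ≤ (rangeFinset f).card := by
  have hle (y : Cube n) (hy : y ∈ (sourceOf f).support) :
      (sourceOf f y).toReal ≤ ((2 : ℝ) ^ k)⁻¹ := by
    have hpos : 0 < (sourceOf f y).toReal :=
      ENNReal.toReal_pos ((PMF.mem_support_iff _ _).1 hy) (PMF.apply_ne_top _ _)
    have h1 : (k : ℝ) ≤ -Real.logb 2 (sourceOf f y).toReal :=
      h.trans (ciInf_le (Set.finite_range _).bddBelow (⟨y, hy⟩ : (sourceOf f).support))
    have h2 : Real.logb 2 (sourceOf f y).toReal ≤ -(k : ℝ) := by linarith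
    rw [Real.logb_le_iff_le_rpow (by norm_num) hpos, Real.rpow_neg (by norm_num),
      Real.rpow_natCast] at h2
    exact h2
  have hsum : ∑ y ∈ rangeFinset f, (sourceOf f y).toReal = 1 := by
    rw [← ENNReal.toReal_sum fun y _ => PMF.apply_ne_top _ _, ← ENNReal.toReal_one,
      ← PMF.tsum_coe (sourceOf f), tsum_eq_sum]
    intro y hy
    rw [PMF.apply_eq_zero_iff, mem_support_sourceOf]
    simpa using hy
  have h1 : (1 : ℝ) ≤ (rangeFinset f).card * ((2 : ℝ) ^ k)⁻¹ := by
    rw [← hsum, ← nsmul_eq_mul]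
    refine Finset.sum_le_card_nsmul _ _ _ fun y hy => hle y ?_
    rw [mem_support_sourceOf]
    simpa using hy
  rw [← div_eq_mul_inv, le_div_iff₀ (by positivity), one_mul] at h1
  exact_mod_cast h1

lemma support_map_sourceOf {m n : ℕ} {f : Cube m → Cube n} {D : Cube n → ZMod 2}
    (h : ∀ b, ∃ x ∈ rangeFinset f, D x = b) : ((sourceOf f).map D).support = Set.univ := by
  refine Set.eq_univ_of_forall fun b => ?_
  obtain ⟨x, hx, rfl⟩ := h b
  rw [PMF.support_map]
  exact ⟨x, mem_support_sourceOf.2 (mem_rangeFinset.1 hx), rfl⟩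

/-! ### Counting the ranges of local maps -/

open Classical in
/-- The ranges of the maps all of whose output bits are computed by functions in `G`. -/
noncomputable def rangesOf {M : ℕ} (n : ℕ) (G : Finset (Cube M → ZMod 2)) : Finset (Finset (Cube n)) :=
  (Fintype.piFinset fun _ : Fin n => G).image fun g => rangeFinset fun y j => g j y

lemma card_rangesOf_le {M : ℕ} (n : ℕ) (G : Finset (Cube M → ZMod 2)) :
    (rangesOf n G).card ≤ G.card ^ n := by
  classical
  refine Finset.card_image_le.trans ?_
  rw [Fintype.card_piFinset_const]

/-- If `f` depends only on the inputs in `U`, and `e` is injective on `U`, then pulling back along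
`e` does not change the range. -/
lemma rangeFinset_comp_eq {m M n : ℕ} {f : Cube m → Cube n} {U : Finset (Fin m)}
    (hf : ∀ x y : Cube m, (∀ i ∈ U, x i = y i) → f x = f y) {e : Fin m → Fin M}
    (he : Set.InjOn e U) : rangeFinset (fun y : Cube M => f (y ∘ e)) = rangeFinset f := by
  ext z
  simp only [mem_rangeFinset]
  constructor
  · rintro ⟨y, rfl⟩
    exact ⟨_, rfl⟩
  · rintro ⟨x, rfl⟩
    classical
    refine ⟨fun u => if h : ∃ i ∈ U, e i = u then x h.choose else 0, hf _ _ fun i hi => ?_⟩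
    have h : ∃ i' ∈ U, e i' = e i := ⟨i, hi, rfl⟩
    simp only [Function.comp_apply, dif_pos h]
    rw [he h.choose_spec.1 hi h.choose_spec.2]

lemma exists_injOn_of_card_le {m M : ℕ} (hM : 0 < M) {U : Finset (Fin m)} (hU : U.card ≤ M) :
    ∃ e : Fin m → Fin M, Set.InjOn e U := by
  have : Nonempty (Fin M) := ⟨⟨0, hM⟩⟩
  obtain ⟨e, -, he⟩ := Set.Finite.exists_injOn_of_encard_le (s := (U : Set (Fin m)))
    (t := (Set.univ : Set (Fin M))) (Finset.finite_toSet U) (by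
      rw [Set.encard_coe_eq_coe_finsetCard, ← Finset.coe_univ, Set.encard_coe_eq_coe_finsetCard]
      simpa using hU)
  exact ⟨e, he⟩

lemma exists_fin_subset_range {α : Type*} [Nonempty α] {T : Finset α} {ℓ : ℕ} (hT : T.card ≤ ℓ) :
    ∃ s : Fin ℓ → α, (T : Set α) ⊆ Set.range s := by
  let a := Classical.arbitrary α
  refine ⟨fun i => if h : (i : ℕ) < T.card then (T.equivFin.symm ⟨i, h⟩ : α) else a, fun x hx => ?_⟩
  refine ⟨⟨T.equivFin ⟨x, hx⟩, (T.equivFin ⟨x, hx⟩).2.trans_le hT⟩, ?_⟩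
  simp

open Classical in
/-- The functions of `M` bits that read at most `ℓ` of them. -/
noncomputable def juntas (M ℓ : ℕ) : Finset (Cube M → ZMod 2) :=
  (Finset.univ : Finset ((Fin ℓ → Fin M) × (Cube ℓ → ZMod 2))).image fun a y => a.2 (y ∘ a.1)

lemma card_juntas_le (M ℓ : ℕ) : (juntas M ℓ).card ≤ M ^ ℓ * 2 ^ 2 ^ ℓ := by
  classical
  refine Finset.card_image_le.trans ?_
  simp [ZMod.card]

lemma mem_juntas {M ℓ : ℕ} (s : Fin ℓ → Fin M) {g : Cube M → ZMod 2}
    (hg : DependsOn g (Set.range s)) : g ∈ juntas M ℓ := by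
  have : Function.FactorsThrough g (fun y : Cube M => y ∘ s) := fun x y hxy =>
    hg (by rintro _ ⟨i, rfl⟩; exact congrFun hxy i)
  obtain ⟨h, rfl⟩ := (Function.factorsThrough_iff _).1 this
  classical
  exact Finset.mem_image.2 ⟨(s, h), Finset.mem_univ _, rfl⟩

/-- All output bits together read at most `n * ℓ` inputs, which can be renamed injectively into `M`
bits. -/
lemma IsLocalMap.rangeFinset_mem {m n ℓ M : ℕ} {f : Cube m → Cube n} (hf : IsLocalMap ℓ f)
    (hM : 0 < M) (hnM : n * ℓ ≤ M) : rangeFinset f ∈ rangesOf n (juntas M ℓ) := by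
  classical
  choose S hS hfS using hf
  have hU : (Finset.univ.biUnion S).card ≤ M := by
    refine Finset.card_biUnion_le.trans (le_trans ?_ hnM)
    simpa using Finset.sum_le_card_nsmul Finset.univ (fun j => (S j).card) ℓ fun j _ => hS j
  obtain ⟨e, he⟩ := exists_injOn_of_card_le hM hU
  have hfU : ∀ x y : Cube m, (∀ i ∈ Finset.univ.biUnion S, x i = y i) → f x = f y :=
    fun x y hxy => funext fun j => hfS j fun i hi =>
      hxy i (Finset.mem_biUnion.2 ⟨j, Finset.mem_univ _, hi⟩)
  have : Nonempty (Fin M) := ⟨⟨0, hM⟩⟩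
  refine Finset.mem_image.2 ⟨fun j y => f (y ∘ e) j, ?_, rangeFinset_comp_eq hfU he⟩
  refine Fintype.mem_piFinset.2 fun j => ?_
  obtain ⟨s, hs⟩ := exists_fin_subset_range ((Finset.card_image_le (f := e)).trans (hS j))
  refine mem_juntas s fun x y hxy => hfS j fun i hi => hxy _ (hs ?_)
  exact Finset.mem_coe.2 (Finset.mem_image_of_mem e hi)

/-! ### Counting the ranges of decision forests -/

namespace DecisionTree

/-- The input bits queried by a decision tree. -/
def vars {m : ℕ} : DecisionTree m → Finset (Fin m)
  | leaf _ => ∅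
  | query i t₀ t₁ => insert i (t₀.vars ∪ t₁.vars)

lemma card_vars_lt {m : ℕ} (t : DecisionTree m) : t.vars.card < 2 ^ t.depth := by
  induction t with
  | leaf b => simp [vars, depth]
  | query i t₀ t₁ h₀ h₁ =>
    have h1 : (query i t₀ t₁).vars.card ≤ t₀.vars.card + t₁.vars.card + 1 :=
      (Finset.card_insert_le _ _).trans (by gcongr; exact Finset.card_union_le _ _)
    have h2 : 2 ^ t₀.depth ≤ 2 ^ max t₀.depth t₁.depth :=
      Nat.pow_le_pow_right (by norm_num) (le_max_left _ _)
    have h3 : 2 ^ t₁.depth ≤ 2 ^ max t₀.depth t₁.depth :=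
      Nat.pow_le_pow_right (by norm_num) (le_max_right _ _)
    rw [depth, pow_succ]
    omega

lemma eval_congr {m : ℕ} (t : DecisionTree m) {x y : Cube m} (h : ∀ i ∈ t.vars, x i = y i) :
    t.eval x = t.eval y := by
  induction t with
  | leaf b => rfl
  | query i t₀ t₁ h₀ h₁ =>
    simp only [vars, Finset.mem_insert, Finset.mem_union] at h
    simp only [eval]
    rw [h i (Or.inl rfl), h₀ fun j hj => h j (Or.inr (Or.inl hj)),
      h₁ fun j hj => h j (Or.inr (Or.inr hj))]

end DecisionTree

open Classical in
/-- The functions computed by complete decision trees of depth `ℓ` on `M` bits. -/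
noncomputable def treeFunctions (M : ℕ) : ℕ → Finset (Cube M → ZMod 2)
  | 0 => Finset.univ.image fun b _ => b
  | ℓ + 1 => (Finset.univ ×ˢ (treeFunctions M ℓ ×ˢ treeFunctions M ℓ)).image
      fun a : Fin M × (Cube M → ZMod 2) × (Cube M → ZMod 2) =>
        fun y => if y a.1 = 0 then a.2.1 y else a.2.2 y

/-- With the extra factor `M`, the recursion `T (ℓ + 1) ≤ M * T ℓ ^ 2` becomes plain squaring,
starting from `2 * M`. -/
lemma card_treeFunctions_mul_le (M ℓ : ℕ) : (treeFunctions M ℓ).card * M ≤ (2 * M) ^ 2 ^ ℓ := by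
  classical
  induction ℓ with
  | zero =>
    have : (treeFunctions M 0).card ≤ 2 := Finset.card_image_le.trans (by simp [ZMod.card])
    simpa using Nat.mul_le_mul_right M this
  | succ ℓ ih =>
    have : (treeFunctions M (ℓ + 1)).card ≤
        M * ((treeFunctions M ℓ).card * (treeFunctions M ℓ).card) :=
      Finset.card_image_le.trans (by simp)
    calc _ ≤ M * ((treeFunctions M ℓ).card * (treeFunctions M ℓ).card) * M := by gcongr
      _ = ((treeFunctions M ℓ).card * M) * ((treeFunctions M ℓ).card * M) := by ring
      _ ≤ (2 * M) ^ 2 ^ ℓ * (2 * M) ^ 2 ^ ℓ := Nat.mul_le_mul ih ih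
      _ = _ := by rw [← pow_add]; ring

lemma DecisionTree.eval_comp_mem_treeFunctions {m M : ℕ} (hM : 0 < M) (e : Fin m → Fin M)
    (t : DecisionTree m) {ℓ : ℕ} (ht : t.depth ≤ ℓ) :
    (fun y : Cube M => t.eval (y ∘ e)) ∈ treeFunctions M ℓ := by
  classical
  have hquery {ℓ : ℕ} (i : Fin M) {g₀ g₁ : Cube M → ZMod 2} (h₀ : g₀ ∈ treeFunctions M ℓ)
      (h₁ : g₁ ∈ treeFunctions M ℓ) :
      (fun y => if y i = 0 then g₀ y else g₁ y) ∈ treeFunctions M (ℓ + 1) :=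
    Finset.mem_image.2 ⟨(i, g₀, g₁), by simp [h₀, h₁], rfl⟩
  induction ℓ generalizing t with
  | zero =>
    rcases t with b | ⟨i, t₀, t₁⟩
    · exact Finset.mem_image.2 ⟨b, Finset.mem_univ _, rfl⟩
    · simp [depth] at ht
  | succ ℓ ih =>
    rcases t with b | ⟨i, t₀, t₁⟩
    -- A shallow leaf is padded by a dummy query with equal subtrees; this uses `0 < M`.
    · have h := ih (leaf b) (Nat.zero_le _)
      simpa [eval] using hquery ⟨0, hM⟩ h h
    · rw [depth, Nat.add_le_add_iff_right, max_le_iff] at ht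
      exact hquery (e i) (ih t₀ ht.1) (ih t₁ ht.2)

lemma IsDecisionForest.rangeFinset_mem {m n ℓ M : ℕ} {f : Cube m → Cube n}
    (hf : IsDecisionForest ℓ f) (hM : 0 < M) (hnM : n * 2 ^ ℓ ≤ M) :
    rangeFinset f ∈ rangesOf n (treeFunctions M ℓ) := by
  classical
  choose t ht hft using hf
  have hU : (Finset.univ.biUnion fun j => (t j).vars).card ≤ M := by
    refine Finset.card_biUnion_le.trans (le_trans ?_ hnM)
    simpa using Finset.sum_le_card_nsmul Finset.univ (fun j => (t j).vars.card) (2 ^ ℓ) fun j _ =>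
      (t j).card_vars_lt.le.trans (Nat.pow_le_pow_right (by norm_num) (ht j))
  obtain ⟨e, he⟩ := exists_injOn_of_card_le hM hU
  have hfU : ∀ x y : Cube m, (∀ i ∈ Finset.univ.biUnion fun j => (t j).vars, x i = y i) →
      f x = f y := by
    intro x y hxy
    funext j
    rw [hft, hft]
    exact (t j).eval_congr fun i hi => hxy i (Finset.mem_biUnion.2 ⟨j, Finset.mem_univ _, hi⟩)
  refine Finset.mem_image.2 ⟨fun j y => f (y ∘ e) j, ?_, rangeFinset_comp_eq hfU he⟩
  refine Fintype.mem_piFinset.2 fun j => ?_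
  simp only [hft]
  exact (t j).eval_comp_mem_treeFunctions hM e (ht j)

/-! ### Numerical estimates -/

lemma pow_le_pow_mul_choose {d k : ℕ} (h : d ≤ k) : k ^ d ≤ d ^ d * k.choose d := by
  induction d generalizing k with
  | zero => simp
  | succ d ih =>
    obtain ⟨k, rfl⟩ : ∃ j, k = j + 1 := ⟨k - 1, by omega⟩
    have hdk : d ≤ k := by omega
    -- Since `d ≤ k`, `d * (k + 1) ≤ (d + 1) * k`.
    have hmul : (k + 1) ^ d ≤ (d + 1) ^ d * k.choose d := by
      rcases Nat.eq_zero_or_pos d with rfl | hd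
      · simp
      refine Nat.le_of_mul_le_mul_left ?_ (pow_pos hd d)
      calc d ^ d * (k + 1) ^ d = (d * (k + 1)) ^ d := (mul_pow _ _ _).symm
        _ ≤ ((d + 1) * k) ^ d := Nat.pow_le_pow_left (by nlinarith) d
        _ = (d + 1) ^ d * k ^ d := mul_pow _ _ _
        _ ≤ (d + 1) ^ d * (d ^ d * k.choose d) := Nat.mul_le_mul_left _ (ih hdk)
        _ = _ := by ring
    calc (k + 1) ^ (d + 1) = (k + 1) ^ d * (k + 1) := pow_succ _ _
      _ ≤ (d + 1) ^ d * k.choose d * (k + 1) := Nat.mul_le_mul_right _ hmul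
      _ = (d + 1) ^ d * ((k + 1) * k.choose d) := by ring
      _ = (d + 1) ^ (d + 1) * (k + 1).choose (d + 1) := by
        rw [Nat.add_one_mul_choose_eq]
        ring

lemma lt_of_mul_rpow_lt {d k : ℕ} {A : ℝ} (hd : 1 ≤ d) (hA : 1 ≤ A)
    (h : (d : ℝ) * A ^ (1 / (d : ℝ)) < k) : d < k := by
  have h1 : (1 : ℝ) ≤ A ^ (1 / (d : ℝ)) := Real.one_le_rpow hA (by positivity)
  have h2 : (d : ℝ) * 1 ≤ d * A ^ (1 / (d : ℝ)) := by gcongr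
  exact_mod_cast (by linarith : (d : ℝ) < k)

lemma lt_choose_of_mul_rpow_lt {d k : ℕ} {A : ℝ} (hd : 1 ≤ d) (hA : 1 ≤ A)
    (h : (d : ℝ) * A ^ (1 / (d : ℝ)) < k) : A < k.choose d := by
  have hd0 : (0 : ℝ) < d := by exact_mod_cast hd
  have hpow : (d : ℝ) ^ d * A < (k : ℝ) ^ d := by
    have := pow_lt_pow_left₀ h (by positivity) (show d ≠ 0 by omega)
    rwa [mul_pow, one_div, Real.rpow_inv_natCast_pow (by linarith) (by omega)] at this
  have hle : (k : ℝ) ^ d ≤ (d : ℝ) ^ d * k.choose d := by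
    exact_mod_cast pow_le_pow_mul_choose (lt_of_mul_rpow_lt hd hA h).le
  exact lt_of_mul_lt_mul_left (hpow.trans_le hle) (by positivity)

lemma card_filter_mul_eight_le {n d k : ℕ} {A : ℝ} (F : Finset (Finset (Cube n))) (hd : 1 ≤ d)
    (hA : 1 ≤ A) (hnA : n ≤ A) (hF : (F.card : ℝ) ≤ 2 ^ A)
    (h : (d : ℝ) * A ^ (1 / (d : ℝ)) < k) :
    (F.filter fun S => 2 ^ k ≤ S.card).card * 8 ≤
      2 ^ ∑ i ∈ Finset.range (d + 1), k.choose i := by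
  have hdk := lt_of_mul_rpow_lt hd hA h
  -- For `d = 1` the sum is only `k + 1`, too little slack for the factor `8`; but then `k > A ≥ n`
  -- and no set has `2 ^ k` points.
  rcases hd.eq_or_lt with rfl | hd2
  · have hnk : n < k := by
      have : (A : ℝ) < k := by simpa using h
      exact_mod_cast hnA.trans_lt this
    rw [Finset.filter_false_of_mem, Finset.card_empty, zero_mul]
    · exact Nat.zero_le _
    · intro S _
      rw [not_le]
      refine (Finset.card_le_univ S).trans_lt ?_
      rw [Fintype.card_fun, ZMod.card, Fintype.card_fin]
      exact Nat.pow_lt_pow_right (by norm_num) hnk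
  · have hlt : F.card ≤ 2 ^ k.choose d := by
      have h1 : (2 : ℝ) ^ A ≤ 2 ^ ((k.choose d : ℕ) : ℝ) :=
        Real.rpow_le_rpow_of_exponent_le (by norm_num) (lt_choose_of_mul_rpow_lt hd hA h).le
      rw [Real.rpow_natCast] at h1
      exact_mod_cast hF.trans h1
    -- The terms `i = 0, 1` contribute `1 + k ≥ 3`, which pays for `8 = 2 ^ 3`.
    have hsum : k.choose d + 3 ≤ ∑ i ∈ Finset.range (d + 1), k.choose i := by
      have : ∑ i ∈ Finset.range 2, k.choose i ≤ ∑ i ∈ Finset.range d, k.choose i :=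
        Finset.sum_le_sum_of_subset (Finset.range_subset_range.2 hd2)
      rw [Finset.sum_range_succ, Finset.sum_range_one, Nat.choose_zero_right,
        Nat.choose_one_right] at this
      rw [Finset.sum_range_succ]
      omega
    calc _ ≤ 2 ^ k.choose d * 8 := Nat.mul_le_mul_right _ ((Finset.card_filter_le _ _).trans hlt)
      _ = 2 ^ (k.choose d + 3) := by rw [pow_add]; norm_num
      _ ≤ _ := Nat.pow_le_pow_right (by norm_num) hsum

lemma card_rangesOf_juntas_le {n ℓ : ℕ} (hn : 1 ≤ n) (hℓn : ℓ ≤ n) :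
    ((rangesOf n (juntas (n * ℓ) ℓ)).card : ℝ) ≤
      2 ^ ((2 : ℝ) ^ ℓ * n + 2 * ℓ * n * Real.logb 2 n) := by
  have hnat : (rangesOf n (juntas (n * ℓ) ℓ)).card ≤ 2 ^ (2 ^ ℓ * n) * n ^ (2 * ℓ * n) :=
    calc _ ≤ (juntas (n * ℓ) ℓ).card ^ n := card_rangesOf_le _ _
      -- Here `ℓ ≤ n` turns `n * ℓ` into `n * n`, the source of the `2` in `2 * ℓ * n * log n`.
      _ ≤ ((n * n) ^ ℓ * 2 ^ 2 ^ ℓ) ^ n := by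
        refine Nat.pow_le_pow_left ((card_juntas_le _ _).trans ?_) n
        gcongr
      _ = _ := by
        rw [mul_pow, ← pow_mul, ← pow_mul, ← pow_two, ← pow_mul, mul_comm, mul_assoc 2 ℓ n]
  have hlog : (2 : ℝ) ^ Real.logb 2 n = n :=
    Real.rpow_logb (by norm_num) (by norm_num) (by exact_mod_cast hn)
  have hreal : (2 : ℝ) ^ ((2 : ℝ) ^ ℓ * n + 2 * ℓ * n * Real.logb 2 n) =
      2 ^ (2 ^ ℓ * n) * (n : ℝ) ^ (2 * ℓ * n) := by
    rw [Real.rpow_add (by norm_num), mul_comm _ (Real.logb 2 n),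
      Real.rpow_mul (by norm_num) (Real.logb 2 n), hlog,
      ← Real.rpow_natCast 2 (2 ^ ℓ * n), ← Real.rpow_natCast (n : ℝ) (2 * ℓ * n)]
    push_cast
    rfl
  rw [hreal]
  exact_mod_cast hnat

lemma card_rangesOf_treeFunctions_le {n ℓ : ℕ} (hn : 1 ≤ n) (hℓ : 1 ≤ ℓ) :
    ((rangesOf n (treeFunctions (n * 2 ^ ℓ) ℓ)).card : ℝ) ≤
      2 ^ ((ℓ + Real.logb 2 n) * (2 : ℝ) ^ (ℓ + 1) * n) := by
  have hM : 1 ≤ n * 2 ^ ℓ := Nat.mul_pos hn (by positivity)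
  have hnat : (rangesOf n (treeFunctions (n * 2 ^ ℓ) ℓ)).card ≤
      (2 ^ (ℓ + 1) * n) ^ (2 ^ ℓ * n) :=
    calc _ ≤ (treeFunctions (n * 2 ^ ℓ) ℓ).card ^ n := card_rangesOf_le _ _
      _ ≤ ((2 * (n * 2 ^ ℓ)) ^ 2 ^ ℓ) ^ n :=
        Nat.pow_le_pow_left ((Nat.le_mul_of_pos_right _ hM).trans (card_treeFunctions_mul_le _ _)) n
      _ = _ := by
        rw [← pow_mul]
        congr 1
        ring
  have hlog : (2 : ℝ) ^ Real.logb 2 n = n :=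
    Real.rpow_logb (by norm_num) (by norm_num) (by exact_mod_cast hn)
  have hlog0 : 0 ≤ Real.logb 2 n := Real.logb_nonneg (by norm_num) (by exact_mod_cast hn)
  have hℓ' : (1 : ℝ) ≤ ℓ := by exact_mod_cast hℓ
  have hreal : ((2 : ℝ) ^ (ℓ + 1) * n) ^ (2 ^ ℓ * n) =
      2 ^ ((ℓ + 1 + Real.logb 2 n) * ((2 : ℝ) ^ ℓ * n)) := by
    rw [Real.rpow_mul (by norm_num), Real.rpow_add (by norm_num), hlog,
      ← Real.rpow_natCast _ (2 ^ ℓ * n), ← Real.rpow_natCast 2 (ℓ + 1)]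
    push_cast
    rfl
  calc ((rangesOf n (treeFunctions (n * 2 ^ ℓ) ℓ)).card : ℝ)
      ≤ ((2 : ℝ) ^ (ℓ + 1) * n) ^ (2 ^ ℓ * n) := by exact_mod_cast hnat
    _ = 2 ^ ((ℓ + 1 + Real.logb 2 n) * ((2 : ℝ) ^ ℓ * n)) := hreal
    -- Uses `ℓ + 1 ≤ 2 * ℓ`.
    _ ≤ 2 ^ ((2 * (ℓ + Real.logb 2 n)) * ((2 : ℝ) ^ ℓ * n)) := by
      refine Real.rpow_le_rpow_of_exponent_le (by norm_num) ?_
      gcongr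
      linarith
    _ = _ := by
      congr 1
      ring

/-! ### The disperser -/

theorem mainTheorem12 (n d ℓ : ℕ) (hℓ : 1 ≤ ℓ) (hℓd : ℓ ≤ d) (hdn : d ≤ n) :
    ∃ p ∈ Poly₂ n d,
      (∀ k : ℕ,
        (d : ℝ) * ((2 : ℝ) ^ ℓ * n + 2 * ℓ * n * Real.logb 2 n) ^ (1 / (d : ℝ)) < k →
          IsDisperser (fun x => MvPolynomial.eval x p) (localSources ℓ n) k) ∧
      (∀ k : ℕ,
        (d : ℝ) * ((ℓ + Real.logb 2 n) * (2 : ℝ) ^ (ℓ + 1) * n) ^ (1 / (d : ℝ)) < k →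
          IsDisperser (fun x => MvPolynomial.eval x p) (decisionForestSources ℓ n) k) := by
  have hd : 1 ≤ d := hℓ.trans hℓd
  have hn : 1 ≤ n := hd.trans hdn
  have hn' : (1 : ℝ) ≤ n := by exact_mod_cast hn
  have hℓ' : (1 : ℝ) ≤ ℓ := by exact_mod_cast hℓ
  have hlog0 : 0 ≤ Real.logb 2 n := Real.logb_nonneg (by norm_num) hn'
  have hpow (j : ℕ) : (1 : ℝ) ≤ 2 ^ j := one_le_pow₀ (by norm_num)
  set A : ℝ := (2 : ℝ) ^ ℓ * n + 2 * ℓ * n * Real.logb 2 n with hA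
  set B : ℝ := (ℓ + Real.logb 2 n) * (2 : ℝ) ^ (ℓ + 1) * n with hB
  have hnA : n ≤ A := by
    have h1 : (1 : ℝ) * n ≤ (2 : ℝ) ^ ℓ * n := by gcongr; exact hpow ℓ
    have h2 : 0 ≤ 2 * ℓ * n * Real.logb 2 n := by positivity
    linarith
  have hnB : n ≤ B :=
    le_mul_of_one_le_left (by linarith) (one_le_mul_of_one_le_of_one_le (by linarith) (hpow _))
  -- The least integers above the thresholds: larger `k` only shrinks the families of supports, so
  -- one polynomial serves every `k`.
  set kA := ⌊(d : ℝ) * A ^ (1 / (d : ℝ))⌋₊ + 1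
  set kB := ⌊(d : ℝ) * B ^ (1 / (d : ℝ))⌋₊ + 1
  have hkA : (d : ℝ) * A ^ (1 / (d : ℝ)) < kA := by exact_mod_cast Nat.lt_floor_add_one _
  have hkB : (d : ℝ) * B ^ (1 / (d : ℝ)) < kB := by exact_mod_cast Nat.lt_floor_add_one _
  have hlarge (F : Finset (Finset (Cube n))) (k : ℕ) :
      ∀ S ∈ F.filter fun S => 2 ^ k ≤ S.card,
        ∑ i ∈ Finset.range (d + 1), k.choose i ≤ lowWeightCount (d + 1) S.card := fun S hS =>
    (sum_choose_le_lowWeightCount _ _).trans (lowWeightCount_mono _ (Finset.mem_filter.1 hS).2)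
  obtain ⟨p, hp, hdisp⟩ := exists_poly_forall_nonconstant (d := d)
    ((rangesOf n (juntas (n * ℓ) ℓ)).filter fun S => 2 ^ kA ≤ S.card)
    ((rangesOf n (treeFunctions (n * 2 ^ ℓ) ℓ)).filter fun S => 2 ^ kB ≤ S.card)
    (hlarge _ _)
    (card_filter_mul_eight_le _ hd (hn'.trans hnA) hnA
      (card_rangesOf_juntas_le hn (hℓd.trans hdn)) hkA)
    (hlarge _ _)
    (card_filter_mul_eight_le _ hd (hn'.trans hnB) hnB
      (card_rangesOf_treeFunctions_le hn hℓ) hkB)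
  have hle {t : ℝ} {k : ℕ} (ht : 0 ≤ t) (hk : t < k) : 2 ^ (⌊t⌋₊ + 1) ≤ 2 ^ k :=
    Nat.pow_le_pow_right (by norm_num) ((Nat.floor_lt ht).2 hk)
  refine ⟨p, hp, fun k hk => ?_, fun k hk => ?_⟩
  · rintro _ ⟨m, f, hf, rfl⟩ hmin
    refine support_map_sourceOf (hdisp _ (Or.inl (Finset.mem_filter.2
      ⟨hf.rangeFinset_mem (Nat.mul_pos hn hℓ) le_rfl, ?_⟩)))
    exact (hle (by positivity) hk).trans (two_pow_le_card_rangeFinset hmin)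
  · rintro _ ⟨m, f, hf, rfl⟩ hmin
    refine support_map_sourceOf (hdisp _ (Or.inr (Finset.mem_filter.2
      ⟨hf.rangeFinset_mem (Nat.mul_pos hn (by positivity)) le_rfl, ?_⟩)))
    exact (hle (by positivity) hk).trans (two_pow_le_card_rangeFinset hmin)
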